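/- Consider an average-cost multi-objective Markov decision process with finite state space $X$, finite action space $U$, transition probabilities $P(x,u,x')$, one-stage cost vector $c(x,u)=(c_1(x,u),\dots,c_K(x,u))$, $K\ge 1$, and initial state distribution $\beta$. For an admissible (possibly randomized, history-dependent, non-stationary) policy $\pi\in\Pi$ let $$J_k(\pi)=\limsup_{T\to\infty}\frac1T\sum_{t=1}^T \mathsf E^\pi_\beta[c_k(X_t,U_t)],\qquad J(\pi)=(J_1(\pi),\dots,J_K(\pi)).$$ A policy $\pi$ is Pareto optimal if there is no $\sigma\in\Pi$ with $J_k(\sigma)\le J_k(\pi)$ for all $k$ and $J_i(\sigma)<J_i(\pi)$ for some $i$. A stationary policy $\pi\in\Pi_{\rm S}$ is given by action probabilities $\pi(u|x)$ and a deterministic policy by a map $X\to U$. Assume that the process is unichain: under every stationary policy the state process has a single recurrent class. Let $\Phi$ be the polytope of all $\phi\ge 0$ on $X\times U$ with $\sum_{x,u}\phi(x,u)=1$ and $\sum_u\phi(x',u)=\sum_{x,u}\phi(x,u)P(x,u,x')$ for all $x'$, and let $\mathcal J^\Phi=\{(\sum_{x,u}\phi(x,u)c_k(x,u))_{k}:\phi\in\Phi\}$.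 A function $f:\mathbb R^K\to\mathbb R$ is strictly increasing on a set $S\subseteq\mathbb R^K$ if $f(a)<f(b)$ for all $a,b\in S$ with $a\le b$ componentwise and $a\ne b$. Theorem. Suppose that either (A) $f$ is strictly increasing on $\{J(\pi):\pi\in\Pi\}$ and $\pi^*$ minimizes $f(J(\pi))$ over all $\pi\in\Pi$; or (B) $f$ is strictly increasing on $\mathcal J^\Phi$ and $\pi^*$ is a stationary policy that minimizes $f(J(\pi))$ over all $\pi\in\Pi_{\rm S}$. Then $\pi^*$ is Pareto optimal (among all $\pi\in\Pi$), and it can be represented as a convex combination of at most $K$ Pareto-optimal deterministic policies, in both of the following senses: (i) there are $m\le K$, Pareto-optimal deterministic policies $\pi_1,\dots,\pi_m$ and weights $\alpha_i\ge 0$ with $\sum_{i=1}^m\alpha_i=1$ such that $J(\pi^*)=\sum_{i=1}^m\alpha_i J(\pi_i)$; (ii) there are $m\le K$, Pareto-optimal deterministic policies $\pi_1,\dots,\pi_m$ and weights $\alpha_i\ge 0$ with $\sum_{i=1}^m\alpha_i=1$ (not necessarily those of (i)) such that the stationary mixing policy $\rho(u|x)=\sum_{i=1}^m\alpha_i\,\pi_i(u|x)$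 satisfies $J(\rho)=J(\pi^*)$. -/

import Mathlib

/-- An average-cost multi-objective Markov decision process with finite state space `X`, finite
action space `U` and `K` objectives: transition kernel, cost vector, initial distribution. -/
structure MOMDP (X U : Type*) [Fintype X] [Fintype U] (K : ℕ) where
  /-- `P x u x'` is the probability of moving from `x` to `x'` under the action `u`. -/
  P : X → U → X → ℝ
  P_nonneg : ∀ x u x', 0 ≤ P x u x'
  P_sum : ∀ x u, ∑ x', P x u x' = 1
  /-- `cost x u k` is the `k`-th one-stage cost. -/
  cost : X → U → Fin K → ℝ
  /-- the distribution of the initial state -/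
  β : X → ℝ
  β_nonneg : ∀ x, 0 ≤ β x
  β_sum : ∑ x, β x = 1

/-- An admissible policy: randomized, history-dependent and non-stationary. `act h x u` is the
probability of choosing the action `u` in the current state `x`, given the list `h` of the past
state-action pairs (most recent pair first; its length is the number of past stages). -/
structure Policy (X U : Type*) [Fintype U] where
  act : List (X × U) → X → U → ℝ
  act_nonneg : ∀ h x u, 0 ≤ act h x u
  act_sum : ∀ h x, ∑ u, act h x u = 1

/-- A Markov stationary (randomized) policy: `prob x u` is the probability of `u` in state `x`. -/
structure StationaryPolicy (X U : Type*) [Fintype U] where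
  prob : X → U → ℝ
  prob_nonneg : ∀ x u, 0 ≤ prob x u
  prob_sum : ∀ x, ∑ u, prob x u = 1

/-- A stationary policy as an admissible policy. -/
def StationaryPolicy.toPolicy {X U : Type*} [Fintype U] (π : StationaryPolicy X U) :
    Policy X U where
  act _ x u := π.prob x u
  act_nonneg _ x u := π.prob_nonneg x u
  act_sum _ x := π.prob_sum x

open Classical in
/-- The deterministic stationary policy that selects the action `d x` in state `x`. -/
noncomputable def StationaryPolicy.deterministic {X U : Type*} [Fintype U] (d : X → U) :
    StationaryPolicy X U where
  prob x u := if u = d x then 1 else 0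
  prob_nonneg x u := by split_ifs <;> norm_num
  prob_sum x := by simp

/-- The class of all stationary policies, as a set of admissible policies. -/
def stationaryPolicies (X U : Type*) [Fintype U] : Set (Policy X U) :=
  Set.range StationaryPolicy.toPolicy

/-- `y` is reachable from `x` in the directed graph of the positive entries of `Q`. -/
def Reaches {X : Type*} (Q : X → X → ℝ) : X → X → Prop :=
  Relation.ReflTransGen (fun x y => 0 < Q x y)

/-- A recurrent class of the finite Markov chain with transition matrix `Q`: a nonempty closed
set of states that communicate with each other. -/
def IsRecurrentClass {X : Type*} (Q : X → X → ℝ) (C : Set X) : Prop :=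
  C.Nonempty ∧ (∀ x ∈ C, ∀ y, 0 < Q x y → y ∈ C) ∧ ∀ x ∈ C, ∀ y ∈ C, Reaches Q x y

namespace MOMDP

variable {X U : Type*} [Fintype X] [Fintype U] {K : ℕ}

/-- The transition matrix of the state process under a stationary policy. -/
def chain (M : MOMDP X U K) (π : StationaryPolicy X U) (x x' : X) : ℝ :=
  ∑ u, π.prob x u * M.P x u x'

/-- Under every stationary policy the state process has a single recurrent class. -/
def Unichain (M : MOMDP X U K) : Prop :=
  ∀ π : StationaryPolicy X U, ∃! C : Set X, IsRecurrentClass (M.chain π) C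

/-- Probability, under the policy `π` and the initial distribution, that the past state-action
pairs are `h` (most recent first) and the current state is `x`. -/
def histProb (M : MOMDP X U K) (π : Policy X U) : List (X × U) → X → ℝ
  | [], x => M.β x
  | (y, v) :: h, x => M.histProb π h y * π.act h y v * M.P y v x

/-- Probability that the `(n+1)`-st state-action pair is `(x, u)`, i.e. that this pair is seen
after `n` past stages. -/
def stageProb (M : MOMDP X U K) (π : Policy X U) (n : ℕ) (x : X) (u : U) : ℝ :=
  ∑ h : Fin n → X × U, M.histProb π (List.ofFn h) x * π.act (List.ofFn h) x u

/-- Expected `k`-th cost at stage `n+1`. -/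
def stageCost (M : MOMDP X U K) (π : Policy X U) (k : Fin K) (n : ℕ) : ℝ :=
  ∑ x, ∑ u, M.stageProb π n x u * M.cost x u k

/-- The vector of long-run average costs (componentwise limit superior). -/
noncomputable def J (M : MOMDP X U K) (π : Policy X U) : Fin K → ℝ := fun k =>
  Filter.limsup (fun T : ℕ => (1 / (T : ℝ)) * ∑ n ∈ Finset.range T, M.stageCost π k n)
    Filter.atTop

/-- The objective vectors achieved by the policies of a class `C`. -/
def achievable (M : MOMDP X U K) (C : Set (Policy X U)) : Set (Fin K → ℝ) :=
  M.J '' C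

/-- The polytope of state-action frequencies: nonnegative, normalized and balanced. -/
def Φ (M : MOMDP X U K) : Set (X → U → ℝ) :=
  {φ | (∀ x', ∑ u, φ x' u = ∑ x, ∑ u, φ x u * M.P x u x') ∧
    (∑ x, ∑ u, φ x u = 1) ∧ ∀ x u, 0 ≤ φ x u}

/-- The objective vectors of the points of the polytope `Φ`. -/
def JΦ (M : MOMDP X U K) : Set (Fin K → ℝ) :=
  (fun φ k => ∑ x, ∑ u, φ x u * M.cost x u k) '' M.Φ

/-- `π` is Pareto optimal among all admissible policies. -/
def ParetoOptimal (M : MOMDP X U K) (π : Policy X U) : Prop :=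
  ¬ ∃ σ : Policy X U, (∀ k, M.J σ k ≤ M.J π k) ∧ ∃ i, M.J σ i < M.J π i

/-- `π` minimizes the scalarized average cost `f (J π)` over the policy class `C`. -/
def ScalarizedOptimal (M : MOMDP X U K) (f : (Fin K → ℝ) → ℝ) (C : Set (Policy X U))
    (π : Policy X U) : Prop :=
  π ∈ C ∧ ∀ σ ∈ C, f (M.J π) ≤ f (M.J σ)

/-- The objective vector of `π` is a convex combination of the objective vectors of at most `K`
Pareto-optimal deterministic policies. -/
def ObjectiveCombination (M : MOMDP X U K) (π : Policy X U) : Prop :=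
  ∃ m ≤ K, ∃ (α : Fin m → ℝ) (d : Fin m → X → U),
    (∀ i, 0 ≤ α i) ∧ ∑ i, α i = 1 ∧
    (∀ i, M.ParetoOptimal (StationaryPolicy.deterministic (d i)).toPolicy) ∧
    M.J π = ∑ i, α i • M.J (StationaryPolicy.deterministic (d i)).toPolicy

/-- The objective vector of `π` is that of a mixing policy `ρ = ∑ i, α i • d i`, a convex
combination (of the action probabilities, with the same weights in every state) of at most `K`
Pareto-optimal deterministic policies. -/
def PolicyCombination (M : MOMDP X U K) (π : Policy X U) : Prop :=
  ∃ m ≤ K, ∃ (α : Fin m → ℝ) (d : Fin m → X → U) (ρ : StationaryPolicy X U),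
    (∀ i, 0 ≤ α i) ∧ ∑ i, α i = 1 ∧
    (∀ i, M.ParetoOptimal (StationaryPolicy.deterministic (d i)).toPolicy) ∧
    (∀ x u, ρ.prob x u = ∑ i, α i * (StationaryPolicy.deterministic (d i)).prob x u) ∧
    M.J π = M.J ρ.toPolicy

end MOMDP

/-! The problem reduces to the polytope `Φ`. For any policy the expected state-action frequencies
accumulate in `Φ`, and a limit point costs at most `J` (`exists_costMap_le_J`). Under the unichain
assumption a stationary policy determines a single point of `Φ`, to which its frequencies converge,
so its `J` is linear in that point (`Unichain.J_eq_costMap`); conversely every point of `Φ` comes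
from a stationary policy. Hence Pareto optimality means that no point of `Φ` dominates `J π`, which
either scalarization hypothesis gives.

Undominatedness is inherited by every point of `Φ` supported in the support of an undominated one
(`Undominated.of_support`), and it forbids any feasible direction with cost `(-1, …, -1)`. The
latter is what lowers the bound from `K + 1` to `K`.

For objective vectors, `Φ` is the hull of the deterministic frequencies; Carathéodory gives affinely
independent points, and `K + 1` of them would span the forbidden direction. For mixing policies, a
frequency of minimal support charges fewer than `K` pairs beyond one per charged state
(`exists_card_charged_lt`), so its conditional policy peels into at most `K` deterministic selectors
(`exists_sum_graphs`). -/

open Filter Topology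

/-! ### Feasible directions and decompositions of nonnegative arrays. -/

section FiniteDimensional

theorem eventually_nonneg_add_mul {ι : Type*} [Finite ι] (φ v : ι → ℝ) (hφ : ∀ i, 0 ≤ φ i)
    (hv : ∀ i, φ i = 0 → v i = 0) : ∀ᶠ t in 𝓝 (0 : ℝ), ∀ i, 0 ≤ φ i + t * v i := by
  refine eventually_all.2 fun i => ?_
  rcases (hφ i).eq_or_lt with h | h
  · simp [← h, hv i h.symm]
  · have : Tendsto (fun t : ℝ => φ i + t * v i) (𝓝 0) (𝓝 (φ i + 0 * v i)) :=
      Continuous.tendsto (by fun_prop) 0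
    rw [zero_mul, add_zero] at this
    exact (this.eventually_const_lt h).mono fun t ht => ht.le

theorem exists_pos_nonneg_add_sub_mul {ι : Type*} [Finite ι] (φ v : ι → ℝ) (hφ : ∀ i, 0 ≤ φ i)
    (hv : ∀ i, φ i = 0 → v i = 0) :
    ∃ t > 0, (∀ i, 0 ≤ φ i + t * v i) ∧ ∀ i, 0 ≤ φ i - t * v i := by
  have h1 := eventually_nonneg_add_mul φ v hφ hv
  have h2 := eventually_nonneg_add_mul φ (-v) hφ (fun i hi => by simp [hv i hi])
  obtain ⟨t, ⟨h1, h2⟩, ht⟩ := (((h1.and h2).filter_mono nhdsWithin_le_nhds).and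
    (self_mem_nhdsWithin (s := Set.Ioi (0 : ℝ)))).exists
  exact ⟨t, ht, h1, fun i => by simpa [sub_eq_add_neg] using h2 i⟩

/-- The ratio test of the simplex method: move along `v` until the first coordinate vanishes. This
is how supports are shrunk. -/
theorem exists_nonneg_add_mul_eq_zero {ι : Type*} [Fintype ι] (φ v : ι → ℝ) (hφ : ∀ i, 0 ≤ φ i)
    (hv : ∀ i, φ i = 0 → v i = 0) (hneg : ∃ i, v i < 0) :
    ∃ t : ℝ, (∀ i, 0 ≤ φ i + t * v i) ∧ ∃ j, φ j ≠ 0 ∧ φ j + t * v j = 0 := by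
  classical
  obtain ⟨j, hj, hmin⟩ := Finset.exists_min_image (Finset.univ.filter fun i => v i < 0)
    (fun i => φ i / (-v i)) (by obtain ⟨i, hi⟩ := hneg; exact ⟨i, by simpa using hi⟩)
  have hj' : v j < 0 := by simpa using hj
  have ht : 0 ≤ φ j / (-v j) := div_nonneg (hφ j) (by linarith)
  refine ⟨φ j / (-v j), fun i => ?_, j, fun h => hj'.ne (hv j h), ?_⟩
  · rcases lt_or_ge (v i) 0 with h | h
    · have := hmin i (by simpa using h)
      rw [le_div_iff₀ (by linarith)] at this
      linarith
    · have := mul_nonneg ht h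
      linarith [hφ i]
  · have := hj'.ne
    field_simp
    ring

theorem LinearMap.surjective_of_injective_of_finrank_le {V W : Type*} [AddCommGroup V]
    [Module ℝ V] [AddCommGroup W] [Module ℝ W] [FiniteDimensional ℝ V] [FiniteDimensional ℝ W]
    (T : V →ₗ[ℝ] W) (hT : Function.Injective T)
    (h : Module.finrank ℝ W ≤ Module.finrank ℝ V) : Function.Surjective T :=
  (LinearMap.injective_iff_surjective_of_finrank_eq_finrank
    (le_antisymm (LinearMap.finrank_le_finrank_of_injective hT) h)).1 hT

/-- Nonnegative functions on a product with all row sums equal to `s` are conic combinations of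
graphs of functions; the number of graphs is controlled by the size of the supports. -/
theorem exists_sum_graphs {X U : Type*} [Fintype X] [Fintype U] [Nonempty X] [DecidableEq U]
    (n : ℕ) : ∀ (s : ℝ) (q : X → U → ℝ), 0 < s → (∀ x u, 0 ≤ q x u) → (∀ x, ∑ u, q x u = s) →
      ∑ x, (Finset.univ.filter fun u => q x u ≠ 0).card ≤ Fintype.card X + n →
      ∃ m ≤ n + 1, ∃ (α : Fin m → ℝ) (d : Fin m → X → U), (∀ i, 0 ≤ α i) ∧ ∑ i, α i = s ∧
        (∀ i x, q x (d i x) ≠ 0) ∧ ∀ x u, q x u = ∑ i, α i * if u = d i x then 1 else 0 := by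
  induction n with
  | zero => ?_
  | succ n ih => ?_
  all_goals
    intro s q hs hq hsum hcard
    have hex : ∀ x, ∃ u, q x u ≠ 0 := fun x => by
      by_contra! h
      have h0 := hsum x
      simp only [h, Finset.sum_const_zero] at h0
      exact hs.ne h0
    choose d hd using hex
    -- Greedy peeling: subtracting the smallest selected entry along the graph of `d` keeps the
    -- array nonnegative with equal row sums and kills the entry at `x₀`.
    obtain ⟨x₀, hx₀⟩ := Finite.exists_min fun x => q x (d x)
    have hpos : 0 < q x₀ (d x₀) := (hq _ _).lt_of_ne (hd x₀).symm
    have hle : q x₀ (d x₀) ≤ s := by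
      rw [← hsum x₀]; exact Finset.single_le_sum (fun u _ => hq x₀ u) (Finset.mem_univ _)
    rcases hle.eq_or_lt with heq | hlt
    · refine ⟨1, by omega, fun _ => s, fun _ => d, fun _ => hs.le, by simp, fun _ x => hd x, ?_⟩
      have hdx : ∀ x, q x (d x) = s := fun x => le_antisymm
        (by rw [← hsum x]; exact Finset.single_le_sum (fun u _ => hq x u) (Finset.mem_univ _))
        (heq ▸ hx₀ x)
      intro x u
      by_cases hu : u = d x
      · simp [hu, hdx]
      · have := Finset.sum_erase_add Finset.univ (q x) (Finset.mem_univ (d x))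
        rw [hsum, hdx] at this
        have h0 : ∑ u ∈ Finset.univ.erase (d x), q x u = 0 := by linarith
        rw [Finset.sum_eq_zero_iff_of_nonneg (fun u _ => hq x u)] at h0
        simp [hu, h0 u (by simp [hu])]
    set q' : X → U → ℝ := fun x u => q x u - q x₀ (d x₀) * if u = d x then 1 else 0 with hq'
    have hq'0 : ∀ x u, 0 ≤ q' x u := fun x u => by
      by_cases hu : u = d x
      · simp [hq', hu, hx₀ x]
      · simp [hq', hu, hq]
    have hq'sum : ∀ x, ∑ u, q' x u = s - q x₀ (d x₀) := fun x => by
      simp [hq', Finset.sum_sub_distrib, hsum]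
    have hsub : ∀ x u, q' x u ≠ 0 → q x u ≠ 0 := fun x u h h0 => by
      by_cases hu : u = d x
      · exact hd x (hu ▸ h0)
      · simp [hq', hu, h0] at h
    have hsub' : ∀ x, (Finset.univ.filter fun u => q' x u ≠ 0) ⊆
        Finset.univ.filter fun u => q x u ≠ 0 := fun x u => by
      simpa using hsub x u
    have hcard' : ∑ x, (Finset.univ.filter fun u => q' x u ≠ 0).card <
        ∑ x, (Finset.univ.filter fun u => q x u ≠ 0).card := by
      refine Finset.sum_lt_sum (fun x _ => Finset.card_le_card (hsub' x))
        ⟨x₀, Finset.mem_univ _, Finset.card_lt_card ⟨hsub' x₀, fun h => ?_⟩⟩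
      have := h (x := d x₀) (by simpa using hd x₀)
      simp [hq'] at this
  -- For `n = 0` no entry is in excess of one per row, but the residual still needs one in each row:
  -- a contradiction.
  · have : ∑ x : X, 1 ≤ ∑ x, (Finset.univ.filter fun u => q' x u ≠ 0).card := by
      refine Finset.sum_le_sum fun x _ => Finset.card_pos.2 ?_
      by_contra! h
      have h1 := hq'sum x
      rw [Finset.filter_eq_empty_iff] at h
      rw [Finset.sum_eq_zero fun u hu => by simpa using h hu] at h1
      linarith
    simp at this hcard hcard'
    omega
  · obtain ⟨m, hm, α, e, hα, hαs, he, hqe⟩ := ih _ q' (sub_pos.2 hlt) hq'0 hq'sum (by omega)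
    refine ⟨m + 1, by omega, Fin.cons (q x₀ (d x₀)) α, Fin.cons d e, ?_, ?_, ?_, ?_⟩
    · refine Fin.cases hpos.le fun i => ?_
      simpa using hα i
    · simp [Fin.sum_univ_succ, hαs]
    · refine Fin.cases hd fun i x => ?_
      simpa using hsub _ _ (he i x)
    · intro x u
      simp only [Fin.sum_univ_succ, Fin.cons_zero, Fin.cons_succ, ← hqe x u, hq']
      ring

end FiniteDimensional

/-! ### Invariant measures of a finite chain with one recurrent class. -/

section Chains

variable {X : Type*} [Fintype X]

/-- A state of `A` with the fewest reachable states works: whatever it reaches has the same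
reachable set. -/
theorem exists_recurrentClass_subset (Q : X → X → ℝ) (A : Set X) (hne : A.Nonempty)
    (hA : ∀ x ∈ A, ∀ y, 0 < Q x y → y ∈ A) : ∃ C ⊆ A, IsRecurrentClass Q C := by
  obtain ⟨x, hx, hmin⟩ := Set.exists_min_image A (fun x => {y | Reaches Q x y}.ncard)
    A.toFinite hne
  have hreach : ∀ y, Reaches Q x y → y ∈ A := fun y h => by
    induction h with
    | refl => exact hx
    | tail _ h ih => exact hA _ ih _ h
  refine ⟨{y | Reaches Q x y}, hreach, ⟨x, Relation.ReflTransGen.refl⟩,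
    fun y hy z hz => Relation.ReflTransGen.tail hy hz, fun y hy z hz => ?_⟩
  have hsub : {z | Reaches Q y z} ⊆ {z | Reaches Q x z} := fun z hz =>
    Relation.ReflTransGen.trans hy hz
  have := Set.eq_of_subset_of_ncard_le hsub (hmin y (hreach y hy)) (Set.toFinite _)
  exact (Set.ext_iff.1 this z).2 hz

theorem not_disjoint_of_closed {Q : X → X → ℝ} (hQ : ∃! C : Set X, IsRecurrentClass Q C)
    {A B : Set X} (hne : A.Nonempty) (hA : ∀ x ∈ A, ∀ y, 0 < Q x y → y ∈ A)
    (hne' : B.Nonempty) (hB : ∀ x ∈ B, ∀ y, 0 < Q x y → y ∈ B) : ¬ Disjoint A B := by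
  obtain ⟨C, hC, hCr⟩ := exists_recurrentClass_subset Q A hne hA
  obtain ⟨D, hD, hDr⟩ := exists_recurrentClass_subset Q B hne' hB
  obtain rfl := hQ.unique hCr hDr
  obtain ⟨x, hx⟩ := hCr.1
  exact Set.not_disjoint_iff.2 ⟨x, hC hx, hD hx⟩

theorem support_closed_of_excessive {Q : X → X → ℝ} (hQ : ∀ x y, 0 ≤ Q x y) {v : X → ℝ}
    (hv : ∀ x, 0 ≤ v x) (h : ∀ y, ∑ x, v x * Q x y ≤ v y) :
    ∀ x ∈ {x | 0 < v x}, ∀ y, 0 < Q x y → y ∈ {x | 0 < v x} := fun x hx y hxy =>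
  lt_of_lt_of_le (mul_pos hx hxy) <| (Finset.single_le_sum (f := fun x => v x * Q x y)
    (fun x _ => mul_nonneg (hv x) (hQ x y)) (Finset.mem_univ x)).trans (h y)

/-- A nonnegative subinvariant function of a finite stochastic matrix is invariant. -/
theorem eq_of_le_sum_mul {Q : X → X → ℝ} (hQ1 : ∀ x, ∑ y, Q x y = 1) {v : X → ℝ}
    (h : ∀ y, v y ≤ ∑ x, v x * Q x y) (y : X) : ∑ x, v x * Q x y = v y := by
  -- The chain conserves total mass, so no inequality in `h` can be strict.
  have hsum : ∑ y, ∑ x, v x * Q x y = ∑ y, v y := by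
    rw [Finset.sum_comm]; simp [← Finset.mul_sum, hQ1]
  exact ((Finset.sum_eq_sum_iff_of_le fun y _ => h y).1 hsum.symm y (Finset.mem_univ y)).symm

theorem posPart_invariant {Q : X → X → ℝ} (hQ : ∀ x y, 0 ≤ Q x y) (hQ1 : ∀ x, ∑ y, Q x y = 1)
    {v : X → ℝ} (hv : ∀ y, ∑ x, v x * Q x y = v y) (y : X) :
    ∑ x, max (v x) 0 * Q x y = max (v y) 0 := by
  refine eq_of_le_sum_mul hQ1 (v := fun x => max (v x) 0) (fun y => max_le ?_ ?_) y
  · rw [← hv y]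
    exact Finset.sum_le_sum fun x _ => mul_le_mul_of_nonneg_right (le_max_left _ _) (hQ x y)
  · exact Finset.sum_nonneg fun x _ => mul_nonneg (le_max_right _ _) (hQ x y)

/-- Otherwise the sets where `μ - ν` is positive and where it is negative are disjoint, closed
(positive parts are invariant) and nonempty (equal masses). -/
theorem invariant_unique {Q : X → X → ℝ} (hQ : ∀ x y, 0 ≤ Q x y) (hQ1 : ∀ x, ∑ y, Q x y = 1)
    (hu : ∃! C : Set X, IsRecurrentClass Q C) {μ ν : X → ℝ}
    (hμ : ∀ y, ∑ x, μ x * Q x y = μ y) (hν : ∀ y, ∑ x, ν x * Q x y = ν y)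
    (h : ∑ x, μ x = ∑ x, ν x) : μ = ν := by
  by_contra hne
  have key : ∀ μ ν : X → ℝ, (∀ y, ∑ x, μ x * Q x y = μ y) → (∀ y, ∑ x, ν x * Q x y = ν y) →
      ∑ x, μ x = ∑ x, ν x → μ ≠ ν → {x | 0 < max (μ x - ν x) 0}.Nonempty ∧
      ∀ x ∈ {x | 0 < max (μ x - ν x) 0}, ∀ y, 0 < Q x y → y ∈ {x | 0 < max (μ x - ν x) 0} := by
    intro μ ν hμ hν h hne
    refine ⟨?_, support_closed_of_excessive hQ (fun x => le_max_right _ _) fun y =>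
      (posPart_invariant (v := fun x => μ x - ν x) hQ hQ1 (fun y => ?_) y).le⟩
    · by_contra hempty
      rw [Set.not_nonempty_iff_eq_empty, Set.eq_empty_iff_forall_notMem] at hempty
      refine hne (funext fun x => (Finset.sum_eq_sum_iff_of_le fun x _ => ?_).1 h x
        (Finset.mem_univ x))
      simpa using hempty x
    · simp [sub_mul, Finset.sum_sub_distrib, hμ, hν]
  have h1 := key μ ν hμ hν h hne
  have h2 := key ν μ hν hμ h.symm (Ne.symm hne)
  refine not_disjoint_of_closed hu h1.1 h1.2 h2.1 h2.2 (Set.disjoint_left.2 fun x hx hx' => ?_)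
  simp at hx hx'
  linarith

/-- No mass leaves `A`, so `ν` cut off to the complement is still invariant; its support would be a
closed set disjoint from `A`. -/
theorem invariant_eq_zero_of_notMem {Q : X → X → ℝ} (hQ : ∀ x y, 0 ≤ Q x y)
    (hQ1 : ∀ x, ∑ y, Q x y = 1) (hu : ∃! C : Set X, IsRecurrentClass Q C) {ν : X → ℝ}
    (hν0 : ∀ x, 0 ≤ ν x) (hν : ∀ y, ∑ x, ν x * Q x y = ν y) {A : Set X} (hne : A.Nonempty)
    (hA : ∀ x ∈ A, ∀ y, 0 < Q x y → y ∈ A) {x : X} (hx : x ∉ A) : ν x = 0 := by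
  classical
  have hAz : ∀ x ∈ A, ∀ y ∉ A, Q x y = 0 := fun x hx y hy =>
    le_antisymm (not_lt.1 fun h => hy (hA x hx y h)) (hQ x y)
  set w : X → ℝ := fun x => if x ∈ A then 0 else ν x with hw
  have hw0 : ∀ x, 0 ≤ w x := fun x => by simp only [hw]; split_ifs <;> simp [hν0]
  have hle : ∀ y, w y ≤ ∑ x, w x * Q x y := fun y => by
    by_cases hy : y ∈ A
    · simpa [hw, hy] using Finset.sum_nonneg fun x _ => mul_nonneg (hw0 x) (hQ x y)
    · rw [show w y = ν y by simp [hw, hy], ← hν y]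
      refine Finset.sum_le_sum fun x _ => ?_
      by_cases hx : x ∈ A
      · simp [hAz x hx y hy]
      · simp [hw, hx]
  have hinv := eq_of_le_sum_mul hQ1 hle
  by_contra h
  refine not_disjoint_of_closed hu hne hA (B := {x | 0 < w x})
    ⟨x, by simpa [hw, hx] using (hν0 x).lt_of_ne (Ne.symm h)⟩
    (support_closed_of_excessive hQ hw0 fun y => (hinv y).le)
    (Set.disjoint_left.2 fun y hy hy' => ?_)
  simp [hw, hy] at hy'

end Chains

namespace MOMDP

variable {X U : Type*} [Fintype X] [Fintype U] {K : ℕ}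

/-! ### The polytope `Φ` and its linear maps. -/

section Linear

/-- The objective vector of a function on state-action pairs, as a linear map. -/
def costMap (M : MOMDP X U K) : (X → U → ℝ) →ₗ[ℝ] (Fin K → ℝ) where
  toFun φ k := ∑ x, ∑ u, φ x u * M.cost x u k
  map_add' φ ψ := by ext k; simp [add_mul, Finset.sum_add_distrib]
  map_smul' t φ := by ext k; simp [mul_assoc, Finset.mul_sum]

/-- Outflow minus inflow at each state, as a linear map. -/
def balance (M : MOMDP X U K) : (X → U → ℝ) →ₗ[ℝ] (X → ℝ) where
  toFun φ x' := ∑ u, φ x' u - ∑ x, ∑ u, φ x u * M.P x u x'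
  map_add' φ ψ := by
    ext k
    simp only [Pi.add_apply, add_mul, Finset.sum_add_distrib]
    ring
  map_smul' t φ := by ext k; simp [mul_assoc, Finset.mul_sum, mul_sub]

/-- The total mass of a function on state-action pairs, as a linear map. -/
def totalMass (X U : Type*) [Fintype X] [Fintype U] : (X → U → ℝ) →ₗ[ℝ] ℝ where
  toFun φ := ∑ x, ∑ u, φ x u
  map_add' φ ψ := by simp [Finset.sum_add_distrib]
  map_smul' t φ := by simp [Finset.mul_sum]

theorem balance_apply (M : MOMDP X U K) (φ : X → U → ℝ) (x' : X) :
    M.balance φ x' = ∑ u, φ x' u - ∑ x, ∑ u, φ x u * M.P x u x' := rfl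

theorem totalMass_apply (φ : X → U → ℝ) : totalMass X U φ = ∑ x, ∑ u, φ x u := rfl

theorem mem_Φ_iff (M : MOMDP X U K) (φ : X → U → ℝ) :
    φ ∈ M.Φ ↔ M.balance φ = 0 ∧ totalMass X U φ = 1 ∧ ∀ x u, 0 ≤ φ x u := by
  rw [Φ, Set.mem_ofPred_eq, funext_iff]
  simp [balance_apply, totalMass_apply, sub_eq_zero]

theorem sum_balance (M : MOMDP X U K) (φ : X → U → ℝ) : ∑ x, M.balance φ x = 0 := by
  simp only [balance_apply, Finset.sum_sub_distrib]
  rw [sub_eq_zero, eq_comm, Finset.sum_comm]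
  refine Finset.sum_congr rfl fun x _ => ?_
  rw [Finset.sum_comm]
  simp [← Finset.mul_sum, M.P_sum]

theorem convex_Φ (M : MOMDP X U K) : Convex ℝ M.Φ := by
  intro φ hφ ψ hψ a b ha hb hab
  rw [mem_Φ_iff] at *
  refine ⟨by simp [hφ.1, hψ.1], by simp [hφ.2.1, hψ.2.1, hab], fun x u => ?_⟩
  have := hφ.2.2 x u
  have := hψ.2.2 x u
  simp only [Pi.add_apply, Pi.smul_apply, smul_eq_mul]
  positivity

theorem add_smul_mem_Φ {M : MOMDP X U K} {φ v : X → U → ℝ} (hφ : φ ∈ M.Φ) (hb : M.balance v = 0)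
    (hm : totalMass X U v = 0) (t : ℝ) (h : ∀ x u, 0 ≤ φ x u + t * v x u) :
    φ + t • v ∈ M.Φ := by
  rw [mem_Φ_iff] at *
  exact ⟨by simp [hφ.1, hb], by simp [hφ.2.1, hm], fun x u => by simpa using h x u⟩

theorem Φ_subset_Icc (M : MOMDP X U K) : M.Φ ⊆ Set.Icc 0 1 := by
  intro φ hφ
  refine ⟨fun x u => hφ.2.2 x u, fun x u => ?_⟩
  calc φ x u ≤ ∑ u, φ x u :=
        Finset.single_le_sum (fun u _ => hφ.2.2 x u) (Finset.mem_univ u)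
    _ ≤ ∑ x, ∑ u, φ x u := Finset.single_le_sum (f := fun x => ∑ u, φ x u)
        (fun x _ => Finset.sum_nonneg fun u _ => hφ.2.2 x u) (Finset.mem_univ x)
    _ = 1 := hφ.2.1

theorem isCompact_Φ (M : MOMDP X U K) : IsCompact M.Φ := by
  refine isCompact_Icc.of_isClosed_subset ?_ M.Φ_subset_Icc
  simp only [Φ, Set.ofPred_and, Set.ofPred_forall]
  refine IsClosed.inter ?_ (IsClosed.inter ?_ ?_)
  · exact isClosed_iInter fun x => isClosed_eq (by fun_prop) (by fun_prop)
  · exact isClosed_eq (by fun_prop) (by fun_prop)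
  · exact isClosed_iInter fun x => isClosed_iInter fun u =>
      isClosed_le (by fun_prop) (by fun_prop)

end Linear

/-! ### Expected frequencies, their limits, and the average cost. -/

section Occupation

theorem histProb_nonneg (M : MOMDP X U K) (π : Policy X U) :
    ∀ h x, 0 ≤ M.histProb π h x
  | [], x => M.β_nonneg x
  | (y, v) :: h, x => mul_nonneg (mul_nonneg (histProb_nonneg M π h y) (π.act_nonneg h y v))
      (M.P_nonneg y v x)

theorem stageProb_nonneg (M : MOMDP X U K) (π : Policy X U) (n : ℕ) (x : X) (u : U) :
    0 ≤ M.stageProb π n x u :=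
  Finset.sum_nonneg fun _ _ => mul_nonneg (M.histProb_nonneg π _ x) (π.act_nonneg _ x u)

theorem sum_stageProb (M : MOMDP X U K) (π : Policy X U) (n : ℕ) (x : X) :
    ∑ u, M.stageProb π n x u = ∑ h : Fin n → X × U, M.histProb π (List.ofFn h) x := by
  simp only [stageProb]
  rw [Finset.sum_comm]
  simp [← Finset.mul_sum, π.act_sum]

theorem sum_stageProb_succ (M : MOMDP X U K) (π : Policy X U) (n : ℕ) (x' : X) :
    ∑ u, M.stageProb π (n + 1) x' u = ∑ x, ∑ u, M.stageProb π n x u * M.P x u x' := by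
  rw [sum_stageProb, ← (Fin.consEquiv fun _ : Fin (n + 1) => X × U).sum_comp,
    Fintype.sum_prod_type, Fintype.sum_prod_type]
  simp [Fin.consEquiv, histProb, stageProb, Finset.sum_mul]

theorem sum_sum_stageProb (M : MOMDP X U K) (π : Policy X U) (n : ℕ) :
    ∑ x, ∑ u, M.stageProb π n x u = 1 := by
  induction n with
  | zero => simp [sum_stageProb, histProb, M.β_sum]
  | succ n ih =>
    simp only [sum_stageProb_succ]
    rw [Finset.sum_comm, ← ih]
    refine Finset.sum_congr rfl fun x _ => ?_
    rw [Finset.sum_comm]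
    simp [← Finset.mul_sum, M.P_sum]

theorem stageProb_toPolicy (M : MOMDP X U K) (π : StationaryPolicy X U) (n : ℕ) (x : X) (u : U) :
    M.stageProb π.toPolicy n x u = (∑ v, M.stageProb π.toPolicy n x v) * π.prob x u := by
  rw [sum_stageProb, stageProb, Finset.sum_mul]
  rfl

/-- Expected frequencies of the state-action pairs over the first `T` stages. -/
noncomputable def frequency (M : MOMDP X U K) (π : Policy X U) (T : ℕ) (x : X) (u : U) : ℝ :=
  (1 / (T : ℝ)) * ∑ n ∈ Finset.range T, M.stageProb π n x u

theorem frequency_nonneg (M : MOMDP X U K) (π : Policy X U) (T : ℕ) (x : X) (u : U) :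
    0 ≤ M.frequency π T x u :=
  mul_nonneg (by positivity) (Finset.sum_nonneg fun _ _ => M.stageProb_nonneg π _ x u)

theorem frequency_eq (M : MOMDP X U K) (π : Policy X U) (T : ℕ) :
    M.frequency π T = (1 / (T : ℝ)) • ∑ n ∈ Finset.range T, M.stageProb π n := by
  ext x u; simp [frequency]

theorem totalMass_frequency (M : MOMDP X U K) (π : Policy X U) (T : ℕ) (hT : T ≠ 0) :
    totalMass X U (M.frequency π T) = 1 := by
  have : ∀ n, totalMass X U (M.stageProb π n) = 1 := M.sum_sum_stageProb π
  rw [frequency_eq, map_smul, map_sum]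
  simp [this, hT]

theorem frequency_mem_Icc (M : MOMDP X U K) (π : Policy X U) (T : ℕ) :
    M.frequency π T ∈ Set.Icc 0 1 := by
  refine ⟨fun x u => M.frequency_nonneg π T x u, fun x u => ?_⟩
  rcases eq_or_ne T 0 with rfl | hT
  · simp [frequency]
  calc M.frequency π T x u ≤ ∑ u, M.frequency π T x u :=
        Finset.single_le_sum (fun u _ => M.frequency_nonneg π T x u) (Finset.mem_univ u)
    _ ≤ ∑ x, ∑ u, M.frequency π T x u :=
        Finset.single_le_sum (f := fun x => ∑ u, M.frequency π T x u)
        (fun x _ => Finset.sum_nonneg fun u _ => M.frequency_nonneg π T x u) (Finset.mem_univ x)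
    _ = 1 := M.totalMass_frequency π T hT

/-- The inflow of one stage is the marginal of the next, so the sum telescopes. The defect is of
order `1 / T`, which puts the limits into `Φ`. -/
theorem balance_frequency (M : MOMDP X U K) (π : Policy X U) (T : ℕ) (x : X) :
    M.balance (M.frequency π T) x =
      (1 / (T : ℝ)) * (M.β x - ∑ u, M.stageProb π T x u) := by
  rw [frequency_eq, map_smul, map_sum, Pi.smul_apply, Finset.sum_apply, smul_eq_mul]
  congr 1
  simp only [balance_apply, ← sum_stageProb_succ]
  rw [Finset.sum_range_sub' (fun n => ∑ u, M.stageProb π n x u)]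
  simp [sum_stageProb, histProb]

theorem costMap_frequency (M : MOMDP X U K) (π : Policy X U) (k : Fin K) (T : ℕ) :
    M.costMap (M.frequency π T) k =
      (1 / (T : ℝ)) * ∑ n ∈ Finset.range T, M.stageCost π k n := by
  rw [frequency_eq, map_smul, map_sum, Pi.smul_apply, Finset.sum_apply, smul_eq_mul]
  rfl

theorem J_eq_limsup (M : MOMDP X U K) (π : Policy X U) (k : Fin K) :
    M.J π k = limsup (fun T => M.costMap (M.frequency π T) k) atTop := by
  simp only [costMap_frequency]; rfl

/-- Along every sequence of horizons, the frequencies accumulate in the polytope. -/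
theorem exists_frequency_limit (M : MOMDP X U K) (π : Policy X U) {τ : ℕ → ℕ}
    (hτ : Tendsto τ atTop atTop) : ∃ φ ∈ M.Φ, ∃ σ : ℕ → ℕ, StrictMono σ ∧
      Tendsto (fun n => M.frequency π (τ (σ n))) atTop (𝓝 φ) := by
  obtain ⟨φ, hφ, σ, hσ, hlim⟩ := (isCompact_Icc (a := (0 : X → U → ℝ)) (b := 1)).tendsto_subseq
    (x := fun n => M.frequency π (τ n)) fun n => M.frequency_mem_Icc π _
  have hτσ : Tendsto (fun n => τ (σ n)) atTop atTop := hτ.comp hσ.tendsto_atTop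
  refine ⟨φ, (M.mem_Φ_iff φ).2 ⟨?_, ?_, hφ.1⟩, σ, hσ, hlim⟩
  · ext x
    have h1 := ((continuous_apply x).comp M.balance.continuous_of_finiteDimensional).tendsto φ
      |>.comp hlim
    refine tendsto_nhds_unique h1 ?_
    have h2 : Tendsto (fun n => (1 / (τ (σ n) : ℝ))) atTop (𝓝 0) :=
      tendsto_one_div_atTop_nhds_zero_nat.comp hτσ
    refine squeeze_zero_norm (a := fun n => (1 / (τ (σ n) : ℝ))) (fun n => ?_) h2
    simp only [Function.comp, balance_frequency]
    rw [norm_mul, Real.norm_of_nonneg (by positivity)]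
    refine mul_le_of_le_one_right (by positivity) ?_
    have hb : M.β x ≤ 1 := by
      rw [← M.β_sum]; exact Finset.single_le_sum (fun x _ => M.β_nonneg x) (Finset.mem_univ x)
    have hs : ∑ u, M.stageProb π (τ (σ n)) x u ≤ 1 := by
      rw [← M.sum_sum_stageProb π (τ (σ n))]
      exact Finset.single_le_sum (f := fun x => ∑ u, M.stageProb π (τ (σ n)) x u)
        (fun x _ => Finset.sum_nonneg fun u _ => M.stageProb_nonneg π _ x u) (Finset.mem_univ x)
    have hs0 : 0 ≤ ∑ u, M.stageProb π (τ (σ n)) x u :=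
      Finset.sum_nonneg fun u _ => M.stageProb_nonneg π _ x u
    rw [Real.norm_eq_abs, abs_le]
    constructor <;> linarith [M.β_nonneg x]
  · have h1 := ((totalMass X U).continuous_of_finiteDimensional.tendsto φ).comp hlim
    refine tendsto_nhds_unique h1 (tendsto_const_nhds.congr' ?_)
    filter_upwards [hτσ.eventually_ne_atTop 0] with n hn
    exact (M.totalMass_frequency π _ hn).symm

/-- One convergent subsequence of frequencies serves all objectives at once, and a limit along a
subsequence is at most the limit superior. -/
theorem exists_costMap_le_J (M : MOMDP X U K) (π : Policy X U) :
    ∃ φ ∈ M.Φ, M.costMap φ ≤ M.J π := by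
  obtain ⟨φ, hφ, σ, hσ, hlim⟩ := M.exists_frequency_limit π tendsto_id
  refine ⟨φ, hφ, fun k => ?_⟩
  have hcont : Continuous fun ψ => M.costMap ψ k :=
    (continuous_apply k).comp M.costMap.continuous_of_finiteDimensional
  have h1 : Tendsto (fun n => M.costMap (M.frequency π (σ n)) k) atTop (𝓝 (M.costMap φ k)) :=
    (hcont.tendsto φ).comp hlim
  -- Comparing limits superior in `ℝ` requires bounded sequences; the frequencies stay in a box.
  obtain ⟨B, hB⟩ := (isCompact_Icc (a := (0 : X → U → ℝ)) (b := 1)).exists_bound_of_continuousOn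
    hcont.continuousOn
  have hB' : ∀ T, |M.costMap (M.frequency π T) k| ≤ B := fun T => hB _ (M.frequency_mem_Icc π T)
  rw [J_eq_limsup, ← h1.limsup_eq]
  refine limsup_le_limsup_of_le (f := map σ atTop) (g := atTop)
    (u := fun T => M.costMap (M.frequency π T) k) hσ.tendsto_atTop ?_ ?_
  · exact h1.isCoboundedUnder_le
  · exact isBoundedUnder_of ⟨B, fun T => (abs_le.1 (hB' T)).2⟩

/-- `φ` disintegrates along the stationary policy `π`. -/
def Disintegrates (φ : X → U → ℝ) (π : StationaryPolicy X U) : Prop :=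
  ∀ x u, φ x u = (∑ v, φ x v) * π.prob x u

theorem frequency_toPolicy (M : MOMDP X U K) (π : StationaryPolicy X U) (T : ℕ) :
    Disintegrates (M.frequency π.toPolicy T) π := by
  intro x u
  simp only [frequency]
  rw [← Finset.mul_sum, Finset.sum_comm, mul_assoc, Finset.sum_mul]
  simp only [← stageProb_toPolicy]

omit [Fintype X] in
theorem disintegrates_of_tendsto {π : StationaryPolicy X U} {φ : X → U → ℝ}
    {F : ℕ → X → U → ℝ} (hF : ∀ n, Disintegrates (F n) π) (h : Tendsto F atTop (𝓝 φ)) :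
    Disintegrates φ π := by
  intro x u
  have h1 : Continuous fun ψ : X → U → ℝ => ψ x u := by fun_prop
  have h2 : Continuous fun ψ : X → U → ℝ => (∑ v, ψ x v) * π.prob x u := by fun_prop
  exact tendsto_nhds_unique ((h1.tendsto φ).comp h)
    (((h2.tendsto φ).comp h).congr fun n => (hF n x u).symm)

theorem chain_nonneg (M : MOMDP X U K) (π : StationaryPolicy X U) (x y : X) :
    0 ≤ M.chain π x y :=
  Finset.sum_nonneg fun u _ => mul_nonneg (π.prob_nonneg x u) (M.P_nonneg x u y)

theorem chain_sum (M : MOMDP X U K) (π : StationaryPolicy X U) (x : X) :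
    ∑ y, M.chain π x y = 1 := by
  simp only [chain]
  rw [Finset.sum_comm]
  simp [← Finset.mul_sum, M.P_sum, π.prob_sum]

theorem marginal_invariant {M : MOMDP X U K} {φ : X → U → ℝ} {π : StationaryPolicy X U}
    (hφ : φ ∈ M.Φ) (h : Disintegrates φ π) (y : X) :
    ∑ x, (∑ u, φ x u) * M.chain π x y = ∑ u, φ y u := by
  rw [hφ.1 y]
  refine Finset.sum_congr rfl fun x _ => ?_
  rw [chain, Finset.mul_sum]
  refine Finset.sum_congr rfl fun u _ => ?_
  rw [h x u, mul_assoc]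

theorem marginal_nonneg {M : MOMDP X U K} {φ : X → U → ℝ} (hφ : φ ∈ M.Φ) (x : X) :
    0 ≤ ∑ u, φ x u := Finset.sum_nonneg fun u _ => hφ.2.2 x u

theorem Unichain.disintegrates_unique {M : MOMDP X U K} (hM : M.Unichain) {φ ψ : X → U → ℝ}
    {π : StationaryPolicy X U} (hφ : φ ∈ M.Φ) (hψ : ψ ∈ M.Φ) (h : Disintegrates φ π)
    (h' : Disintegrates ψ π) : φ = ψ := by
  have := invariant_unique (M.chain_nonneg π) (M.chain_sum π) (hM π) (marginal_invariant hφ h)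
    (marginal_invariant hψ h') (hφ.2.1.trans hψ.2.1.symm)
  ext x u
  rw [h, h' x u, congrFun this x]

theorem exists_disintegrates (M : MOMDP X U K) (π : StationaryPolicy X U) :
    ∃ φ ∈ M.Φ, Disintegrates φ π := by
  obtain ⟨φ, hφ, σ, -, hlim⟩ := M.exists_frequency_limit π.toPolicy tendsto_id
  exact ⟨φ, hφ, disintegrates_of_tendsto (fun n => M.frequency_toPolicy π _) hlim⟩

/-- All limit points of the frequencies disintegrate along `π`, so they coincide with `φ` and the
limit superior is a limit. -/
theorem Unichain.J_eq_costMap {M : MOMDP X U K} (hM : M.Unichain) {φ : X → U → ℝ}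
    {π : StationaryPolicy X U} (hφ : φ ∈ M.Φ) (h : Disintegrates φ π) :
    M.J π.toPolicy = M.costMap φ := by
  have hlim : Tendsto (M.frequency π.toPolicy) atTop (𝓝 φ) := by
    refine tendsto_of_subseq_tendsto fun τ hτ => ?_
    obtain ⟨ψ, hψ, σ, -, hσ⟩ := M.exists_frequency_limit π.toPolicy hτ
    have := disintegrates_of_tendsto (fun n => M.frequency_toPolicy π _) hσ
    exact ⟨σ, hM.disintegrates_unique hφ hψ h this ▸ hσ⟩
  ext k
  rw [J_eq_limsup]
  have hcont : Continuous fun ψ => M.costMap ψ k :=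
    (continuous_apply k).comp M.costMap.continuous_of_finiteDimensional
  exact ((hcont.tendsto φ).comp hlim).limsup_eq

/-- Conditional probabilities on the charged states. Elsewhere the choice is free; a single action
is taken so that uncharged states add no randomization. -/
theorem exists_stationary_disintegrates {M : MOMDP X U K} {φ : X → U → ℝ} (hφ : φ ∈ M.Φ) :
    ∃ π : StationaryPolicy X U, Disintegrates φ π ∧
      (∀ x u, ∑ v, φ x v ≠ 0 → (π.prob x u = 0 ↔ φ x u = 0)) ∧
      ∀ x, ∑ v, φ x v = 0 → ∃ u₀, ∀ u, π.prob x u ≠ 0 → u = u₀ := by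
  classical
  have hU : Nonempty U := by
    by_contra h
    rw [not_nonempty_iff] at h
    simpa using hφ.2.1
  obtain ⟨u₀⟩ := hU
  refine ⟨⟨fun x u => if ∑ v, φ x v = 0 then (if u = u₀ then 1 else 0) else
    φ x u / ∑ v, φ x v, fun x u => ?_, fun x => ?_⟩, fun x u => ?_, fun x u h => ?_,
    fun x h => ⟨u₀, fun u => ?_⟩⟩
  · have h1 := marginal_nonneg hφ x
    have h2 := hφ.2.2 x u
    split_ifs <;> positivity
  · by_cases h : ∑ v, φ x v = 0
    · simp [h]
    · simp only [h, if_false, ← Finset.sum_div]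
      exact div_self h
  · by_cases h : ∑ v, φ x v = 0
    · simpa [h] using (Finset.sum_eq_zero_iff_of_nonneg fun u _ => hφ.2.2 x u).1 h u
        (Finset.mem_univ u)
    · simp only [h, if_false]
      field_simp
  · simp [h]
  · simp [h]

end Occupation

end MOMDP

namespace MOMDP

variable {X U : Type*} [Fintype X] [Fintype U] {K : ℕ}

/-! ### Pareto optimality as undominatedness in the polytope. -/

section Pareto

/-- No objective vector of the polytope dominates `p`. -/
def Undominated (M : MOMDP X U K) (p : Fin K → ℝ) : Prop :=
  ∀ ψ ∈ M.Φ, M.costMap ψ ≤ p → M.costMap ψ = p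

theorem Unichain.exists_stationary_J_eq {M : MOMDP X U K} (hM : M.Unichain) {φ : X → U → ℝ}
    (hφ : φ ∈ M.Φ) : ∃ π : StationaryPolicy X U, M.J π.toPolicy = M.costMap φ := by
  obtain ⟨π, hπ, -⟩ := exists_stationary_disintegrates hφ
  exact ⟨π, hM.J_eq_costMap hφ hπ⟩

theorem Unichain.J_stationary_mem {M : MOMDP X U K} (hM : M.Unichain)
    (π : StationaryPolicy X U) : M.J π.toPolicy ∈ M.JΦ := by
  obtain ⟨φ, hφ, h⟩ := M.exists_disintegrates π
  exact ⟨φ, hφ, (hM.J_eq_costMap hφ h).symm⟩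

theorem ParetoOptimal.undominated {M : MOMDP X U K} {π : Policy X U} (h : M.ParetoOptimal π)
    (hM : M.Unichain) : M.Undominated (M.J π) := by
  intro ψ hψ hle
  obtain ⟨σ, hσ⟩ := hM.exists_stationary_J_eq hψ
  by_contra hne
  obtain ⟨i, hi⟩ := (Pi.lt_def.1 (hle.lt_of_ne hne)).2
  refine h ⟨σ.toPolicy, ?_, i, ?_⟩
  · rw [hσ]; exact hle
  · rw [hσ]; exact hi

theorem Undominated.paretoOptimal {M : MOMDP X U K} {π : Policy X U}
    (h : M.Undominated (M.J π)) : M.ParetoOptimal π := by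
  rintro ⟨σ, hσ, i, hi⟩
  obtain ⟨φ, hφ, hle⟩ := M.exists_costMap_le_J σ
  have := congrFun (h φ hφ (hle.trans hσ)) i
  exact absurd (hle i) (by linarith)

theorem ParetoOptimal.exists_costMap_eq {M : MOMDP X U K} {π : Policy X U}
    (h : M.ParetoOptimal π) (hM : M.Unichain) : ∃ φ ∈ M.Φ, M.costMap φ = M.J π := by
  obtain ⟨φ, hφ, hle⟩ := M.exists_costMap_le_J π
  exact ⟨φ, hφ, h.undominated hM φ hφ hle⟩

/-- Undominatedness passes to all points of the minimal face of the polytope. -/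
theorem Undominated.of_support {M : MOMDP X U K} {φ ψ : X → U → ℝ}
    (h : M.Undominated (M.costMap φ)) (hφ : φ ∈ M.Φ) (hψ : ψ ∈ M.Φ)
    (hsupp : ∀ x u, φ x u = 0 → ψ x u = 0) : M.Undominated (M.costMap ψ) := by
  intro χ hχ hle
  obtain ⟨t, ht, -, hpos⟩ := exists_pos_nonneg_add_sub_mul (fun s : X × U => φ s.1 s.2)
    (fun s => ψ s.1 s.2) (fun s => hφ.2.2 _ _) fun s => hsupp _ _
  have hχ' := (M.mem_Φ_iff χ).1 hχ
  have hψ' := (M.mem_Φ_iff ψ).1 hψ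
  -- Exchanging a little of `ψ` for `χ` inside `φ` transfers any domination of `ψ` to `φ`.
  have hmem : φ + t • (χ - ψ) ∈ M.Φ := by
    refine add_smul_mem_Φ hφ (by simp [hχ'.1, hψ'.1]) (by simp [hχ'.2.1, hψ'.2.1]) t
      fun x u => ?_
    have := hpos (x, u)
    have := mul_nonneg ht.le (hχ.2.2 x u)
    simp only [Pi.sub_apply, mul_sub]
    linarith
  have heq : M.costMap (φ + t • (χ - ψ)) = M.costMap φ + t • (M.costMap χ - M.costMap ψ) := by
    simp
  have h0 := h _ hmem (by
    rw [heq]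
    exact add_le_of_nonpos_right
      (smul_nonpos_of_nonneg_of_nonpos ht.le (sub_nonpos.2 hle)))
  rw [heq, add_eq_left, smul_eq_zero] at h0
  exact sub_eq_zero.1 (h0.resolve_left ht.ne')

/-- A perturbation in the face of `φ` cannot decrease all the costs. -/
theorem Undominated.not_costMap_eq_neg_one {M : MOMDP X U K} (hK : 0 < K) {φ v : X → U → ℝ}
    (h : M.Undominated (M.costMap φ)) (hφ : φ ∈ M.Φ) (hv : ∀ x u, φ x u = 0 → v x u = 0)
    (hb : M.balance v = 0) (hm : totalMass X U v = 0) : M.costMap v ≠ fun _ => -1 := by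
  intro hc
  obtain ⟨t, ht, hpos, -⟩ := exists_pos_nonneg_add_sub_mul (fun s : X × U => φ s.1 s.2)
    (fun s => v s.1 s.2) (fun s => hφ.2.2 _ _) fun s => hv _ _
  have heq : M.costMap (φ + t • v) = M.costMap φ + fun _ => -t := by
    rw [map_add, map_smul, hc]; ext; simp
  have h0 := h _ (add_smul_mem_Φ hφ hb hm t fun x u => hpos (x, u)) (by
    rw [heq]; exact fun k => by simp [ht.le])
  rw [heq] at h0
  -- An objective must exist: for `K = 0` the zero vector is the vector of `-1`s.
  have := congrFun h0 ⟨0, hK⟩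
  simp at this
  exact ht.ne' this

end Pareto

/-! ### Support bounds by counting equations. -/

section Rank

/-- The state-action pairs charged by `φ`. -/
abbrev Charged (φ : X → U → ℝ) : Type _ := {s : X × U // φ s.1 s.2 ≠ 0}

/-- The states charged by `φ`. -/
abbrev ChargedState (φ : X → U → ℝ) : Type _ := {x : X // ∑ u, φ x u ≠ 0}

open Classical in
/-- Extension by zero of a function on the pairs charged by `φ`. -/
noncomputable def extendZero (φ : X → U → ℝ) : (Charged φ → ℝ) →ₗ[ℝ] (X → U → ℝ) where
  toFun v x u := if h : φ x u ≠ 0 then v ⟨(x, u), h⟩ else 0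
  map_add' v w := by ext x u; by_cases h : φ x u = 0 <;> simp [h]
  map_smul' t v := by ext x u; by_cases h : φ x u = 0 <;> simp [h]

omit [Fintype X] [Fintype U] in
theorem extendZero_of_eq_zero {φ : X → U → ℝ} (v : Charged φ → ℝ) (x : X) (u : U)
    (h : φ x u = 0) : extendZero φ v x u = 0 := by
  simp [extendZero, h]

omit [Fintype X] [Fintype U] in
theorem extendZero_apply {φ : X → U → ℝ} (v : Charged φ → ℝ) (s : Charged φ) :
    extendZero φ v s.1.1 s.1.2 = v s := by
  simp [extendZero, s.2]

/-- The balance and normalization equations on the pairs charged by `φ`, as a linear map. -/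
noncomputable def balanceOn (M : MOMDP X U K) (φ : X → U → ℝ) :
    (Charged φ → ℝ) →ₗ[ℝ] (ChargedState φ → ℝ) where
  toFun v x := M.balance (extendZero φ v) x + totalMass X U (extendZero φ v) * ∑ u, φ x u
  map_add' v w := by ext x; simp only [map_add, Pi.add_apply]; ring
  map_smul' t v := by
    ext x; simp only [map_smul, Pi.smul_apply, smul_eq_mul, RingHom.id_apply]; ring

theorem marginal_eq_zero_iff {M : MOMDP X U K} {φ : X → U → ℝ} (hφ : φ ∈ M.Φ) (x : X) :
    ∑ u, φ x u = 0 ↔ ∀ u, φ x u = 0 := by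
  rw [Finset.sum_eq_zero_iff_of_nonneg fun u _ => hφ.2.2 x u]
  simp

theorem P_eq_zero_of_marginal_eq_zero {M : MOMDP X U K} {φ : X → U → ℝ} (hφ : φ ∈ M.Φ) {y : X}
    (hy : ∑ u, φ y u = 0) {x : X} {u : U} (h : φ x u ≠ 0) : M.P x u y = 0 := by
  have hnn : ∀ x u, 0 ≤ φ x u * M.P x u y := fun x u =>
    mul_nonneg (hφ.2.2 x u) (M.P_nonneg x u y)
  rw [hφ.1 y, Finset.sum_eq_zero_iff_of_nonneg
    fun x _ => Finset.sum_nonneg fun u _ => hnn x u] at hy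
  have := (Finset.sum_eq_zero_iff_of_nonneg fun u _ => hnn x u).1 (hy x (Finset.mem_univ x)) u
    (Finset.mem_univ u)
  exact (mul_eq_zero.1 this).resolve_left h

/-- The balances sum to zero and `φ` has mass one, so summing the equations isolates the total mass:
normalization costs no extra equation. Uncharged states are balanced automatically, since no charged
pair leads to them. -/
theorem balanceOn_eq_zero {M : MOMDP X U K} {φ : X → U → ℝ} (hφ : φ ∈ M.Φ)
    {v : Charged φ → ℝ} (h : M.balanceOn φ v = 0) :
    M.balance (extendZero φ v) = 0 ∧ totalMass X U (extendZero φ v) = 0 := by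
  have hout : ∀ x, ∑ u, φ x u = 0 → M.balance (extendZero φ v) x = 0 := by
    intro y hy
    have h0 := (marginal_eq_zero_iff hφ y).1 hy
    rw [balance_apply, Finset.sum_eq_zero fun u _ => extendZero_of_eq_zero v y u (h0 u),
      zero_sub, neg_eq_zero]
    refine Finset.sum_eq_zero fun x _ => Finset.sum_eq_zero fun u _ => ?_
    by_cases hxu : φ x u = 0
    · rw [extendZero_of_eq_zero v x u hxu, zero_mul]
    · rw [P_eq_zero_of_marginal_eq_zero hφ hy hxu, mul_zero]
  have hall : ∀ x, M.balance (extendZero φ v) x +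
      totalMass X U (extendZero φ v) * ∑ u, φ x u = 0 := fun x => by
    by_cases hx : ∑ u, φ x u = 0
    · rw [hout x hx, hx]; ring
    · exact congrFun h ⟨x, hx⟩
  have hmass : totalMass X U (extendZero φ v) = 0 := by
    have := Finset.sum_eq_zero fun x (_ : x ∈ Finset.univ) => hall x
    rwa [Finset.sum_add_distrib, sum_balance, ← Finset.mul_sum, hφ.2.1, zero_add,
      mul_one] at this
  refine ⟨funext fun x => ?_, hmass⟩
  simpa [hmass] using hall x

-- A kernel vector of `balanceOn` would move `φ` both ways inside `Φ`; extremality makes the map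
-- injective.
open Classical in
theorem card_charged_le_of_mem_extremePoints {M : MOMDP X U K} {φ : X → U → ℝ}
    (h : φ ∈ M.Φ.extremePoints ℝ) :
    Fintype.card (Charged φ) ≤ Fintype.card (ChargedState φ) := by
  have hφ := h.1
  have hinj : Function.Injective (M.balanceOn φ) := by
    rw [injective_iff_map_eq_zero]
    intro v hv
    obtain ⟨hb, hm⟩ := balanceOn_eq_zero hφ hv
    obtain ⟨t, ht, h1, h2⟩ := exists_pos_nonneg_add_sub_mul (fun s : X × U => φ s.1 s.2)
      (fun s => extendZero φ v s.1 s.2) (fun s => hφ.2.2 _ _)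
      fun s => extendZero_of_eq_zero v _ _
    have m1 := add_smul_mem_Φ hφ hb hm t fun x u => h1 (x, u)
    have m2 := add_smul_mem_Φ hφ hb hm (-t) fun x u => by
      simpa [sub_eq_add_neg] using h2 (x, u)
    have := h.2 m1 m2 ⟨1 / 2, 1 / 2, by norm_num, by norm_num, by norm_num, by
      ext x u; simp; ring⟩
    rw [add_eq_left, smul_eq_zero] at this
    ext s
    rw [← extendZero_apply v s, this.resolve_left ht.ne']
    rfl
  simpa using LinearMap.finrank_le_finrank_of_injective hinj

-- With `φ` of minimal support, the equations and costs together are injective on the charged pairs.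
-- They are not surjective, since balanced directions cannot lower all costs; this makes the
-- inequality strict.
open Classical in
theorem exists_card_charged_lt {M : MOMDP X U K} (hK : 0 < K) {p : Fin K → ℝ}
    (hp : M.Undominated p) (hex : ∃ φ ∈ M.Φ, M.costMap φ = p) :
    ∃ φ ∈ M.Φ, M.costMap φ = p ∧
      Fintype.card (Charged φ) < Fintype.card (ChargedState φ) + K := by
  have hne : ∃ n, ∃ φ ∈ M.Φ, M.costMap φ = p ∧ Fintype.card (Charged φ) = n := by
    obtain ⟨φ, h1, h2⟩ := hex
    exact ⟨_, φ, h1, h2, rfl⟩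
  obtain ⟨φ, hφ, rfl, hcard⟩ := Nat.find_spec hne
  have hmin : ∀ ψ ∈ M.Φ, M.costMap ψ = M.costMap φ →
      Fintype.card (Charged φ) ≤ Fintype.card (Charged ψ) := fun ψ h1 h2 =>
    hcard.le.trans (Nat.find_min' hne ⟨ψ, h1, h2, rfl⟩)
  refine ⟨φ, hφ, rfl, ?_⟩
  set T := (M.balanceOn φ).prod (M.costMap ∘ₗ extendZero φ) with hT
  have hinj : Function.Injective T := by
    rw [injective_iff_map_eq_zero]
    intro v hv
    obtain ⟨hv, hc⟩ := Prod.mk.inj hv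
    obtain ⟨hb, hm⟩ := balanceOn_eq_zero hφ hv
    by_contra hne0
    -- A nonzero vector of total mass zero has a negative entry, so the ratio test applies and drops
    -- a charged pair at equal cost.
    have hneg : ∃ s : X × U, extendZero φ v s.1 s.2 < 0 := by
      by_contra! hnn
      refine hne0 (funext fun s => ?_)
      have h1 : ∑ s : X × U, extendZero φ v s.1 s.2 = 0 := by
        rw [Fintype.sum_prod_type]; exact hm
      rw [← extendZero_apply v s]
      exact (Finset.sum_eq_zero_iff_of_nonneg fun s _ => hnn s).1 h1 s.1 (Finset.mem_univ _)
    obtain ⟨t, ht, s, hs, hs'⟩ := exists_nonneg_add_mul_eq_zero (fun s : X × U => φ s.1 s.2)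
      (fun s => extendZero φ v s.1 s.2) (fun s => hφ.2.2 _ _)
      (fun s => extendZero_of_eq_zero v _ _) hneg
    have hle := hmin _ (add_smul_mem_Φ hφ hb hm t fun x u => ht (x, u)) (by
      rw [map_add, map_smul, show M.costMap (extendZero φ v) = 0 from hc, smul_zero, add_zero])
    rw [Fintype.card_subtype, Fintype.card_subtype] at hle
    refine hle.not_gt (Finset.card_lt_card ⟨fun s hs => ?_, fun h => ?_⟩)
    · simp only [Finset.mem_filter, Finset.mem_univ, true_and] at hs ⊢
      intro h0
      exact hs (by simp [h0, extendZero_of_eq_zero v _ _ h0])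
    · have := h (show s ∈ _ by simpa using hs)
      simp only [Finset.mem_filter, Finset.mem_univ, true_and] at this
      exact this hs'
  by_contra! hle
  have hsurj := T.surjective_of_injective_of_finrank_le hinj (by simpa using hle)
  obtain ⟨v, hv⟩ := hsurj (0, fun _ => -1)
  obtain ⟨hv, hc⟩ := Prod.mk.inj hv
  obtain ⟨hb, hm⟩ := balanceOn_eq_zero hφ hv
  exact hp.not_costMap_eq_neg_one hK hφ (extendZero_of_eq_zero v) hb hm hc

end Rank

/-! ### The two decompositions into deterministic policies. -/

section Combination

theorem nonempty_state (M : MOMDP X U K) : Nonempty X := by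
  by_contra h
  rw [not_nonempty_iff] at h
  simpa using M.β_sum

open Classical in
theorem exists_mixing {M : MOMDP X U K} {φ : X → U → ℝ} (hφ : φ ∈ M.Φ) (n : ℕ)
    (hcard : Fintype.card (Charged φ) ≤ Fintype.card (ChargedState φ) + n) :
    ∃ ρ : StationaryPolicy X U, Disintegrates φ ρ ∧
      ∃ m ≤ n + 1, ∃ (α : Fin m → ℝ) (d : Fin m → X → U), (∀ i, 0 ≤ α i) ∧ ∑ i, α i = 1 ∧
        (∀ i x, ∑ u, φ x u ≠ 0 → φ x (d i x) ≠ 0) ∧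
        ∀ x u, ρ.prob x u = ∑ i, α i * (StationaryPolicy.deterministic (d i)).prob x u := by
  obtain ⟨ρ, hρ, h1, h2⟩ := exists_stationary_disintegrates hφ
  have := M.nonempty_state
  -- Summed over the states, this bounds the support of `ρ` by one action per state plus `n`,
  -- without subtraction in `ℕ`.
  have hbound : ∀ x, (Finset.univ.filter fun u => ρ.prob x u ≠ 0).card +
      (if ∑ u, φ x u ≠ 0 then 1 else 0) ≤
      (Finset.univ.filter fun u => φ x u ≠ 0).card + 1 := by
    intro x
    by_cases hx : ∑ u, φ x u = 0
    · obtain ⟨u₀, hu₀⟩ := h2 x hx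
      have : (Finset.univ.filter fun u => ρ.prob x u ≠ 0).card ≤ 1 :=
        Finset.card_le_one_iff.2 fun {a b} ha hb => by
          rw [hu₀ a (by simpa using ha), hu₀ b (by simpa using hb)]
      rw [if_neg (not_not.2 hx)]
      omega
    · simp [hx, h1 x _ hx]
  have hsum := Finset.sum_le_sum fun x (_ : x ∈ Finset.univ) => hbound x
  rw [Finset.sum_add_distrib, Finset.sum_add_distrib, ← Finset.card_filter,
    ← Fintype.card_subtype] at hsum
  have hS : Fintype.card (Charged φ) =
      ∑ x, (Finset.univ.filter fun u => φ x u ≠ 0).card := by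
    simp only [Fintype.card_subtype, Finset.card_filter, Fintype.sum_prod_type]
  have hR : Fintype.card {x // ∑ u, φ x u ≠ 0} = Fintype.card (ChargedState φ) := rfl
  rw [← hS, hR] at hsum
  simp only [Finset.sum_const, Finset.card_univ, smul_eq_mul, mul_one] at hsum
  obtain ⟨m, hm, α, d, hα, hα1, hd, hq⟩ := exists_sum_graphs n 1 ρ.prob one_pos ρ.prob_nonneg
    ρ.prob_sum (by omega)
  exact ⟨ρ, hρ, m, hm, α, d, hα, hα1, fun i x hx h0 => hd i x ((h1 x _ hx).2 h0), hq⟩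

/-- Selecting in each charged state a charged action yields frequencies in the same face. -/
theorem Unichain.eq_zero_of_deterministic {M : MOMDP X U K} (hM : M.Unichain) {φ ψ : X → U → ℝ}
    {d : X → U} (hφ : φ ∈ M.Φ) (hd : ∀ x, ∑ u, φ x u ≠ 0 → φ x (d x) ≠ 0) (hψ : ψ ∈ M.Φ)
    (h : Disintegrates ψ (StationaryPolicy.deterministic d)) (x : X) (u : U)
    (hxu : φ x u = 0) : ψ x u = 0 := by
  classical
  by_cases hu : u = d x
  · have hx : ∑ u, φ x u = 0 := by
      by_contra hx
      exact hd x hx (hu ▸ hxu)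
    -- The states charged by `φ` are closed under the chain of `d`, so `ψ` gives no mass to the
    -- others.
    rw [h, invariant_eq_zero_of_notMem (M.chain_nonneg _) (M.chain_sum _) (hM _)
      (marginal_nonneg hψ) (marginal_invariant hψ h) (A := {x | ∑ u, φ x u ≠ 0}) ?_ ?_
      (by simpa using hx), zero_mul]
    · by_contra hne
      rw [Set.not_nonempty_iff_eq_empty, Set.eq_empty_iff_forall_notMem] at hne
      have := hφ.2.1
      rw [Finset.sum_eq_zero fun x _ => by simpa using hne x] at this
      exact zero_ne_one this
    · intro y hy z hyz hz
      simp [chain, StationaryPolicy.deterministic,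
        P_eq_zero_of_marginal_eq_zero hφ hz (hd y hy)] at hyz
  · rw [h]
    simp [StationaryPolicy.deterministic, hu]

theorem ParetoOptimal.policyCombination {M : MOMDP X U K} {π : Policy X U}
    (h : M.ParetoOptimal π) (hK : 0 < K) (hM : M.Unichain) : M.PolicyCombination π := by
  classical
  have hund := h.undominated hM
  obtain ⟨φ, hφ, hc, hcard⟩ := exists_card_charged_lt hK hund (h.exists_costMap_eq hM)
  obtain ⟨ρ, hρ, m, hm, α, d, hα, hα1, hd, hq⟩ := exists_mixing hφ (K - 1) (by omega)
  refine ⟨m, by omega, α, d, ρ, hα, hα1, fun i => Undominated.paretoOptimal ?_, hq, ?_⟩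
  swap
  · rw [hM.J_eq_costMap hφ hρ, hc]
  obtain ⟨ψ, hψ, hψd⟩ := M.exists_disintegrates (StationaryPolicy.deterministic (d i))
  rw [hM.J_eq_costMap hψ hψd]
  rw [← hc] at hund
  exact hund.of_support hφ hψ (hM.eq_zero_of_deterministic hφ (hd i) hψ hψd)

/-- The case `n = 0` of `exists_mixing`: a single selector remains. -/
theorem exists_deterministic_of_mem_extremePoints {M : MOMDP X U K} {φ : X → U → ℝ}
    (h : φ ∈ M.Φ.extremePoints ℝ) :
    ∃ d : X → U, Disintegrates φ (StationaryPolicy.deterministic d) := by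
  classical
  obtain ⟨ρ, hρ, m, hm, α, d, -, hα1, -, hq⟩ :=
    exists_mixing h.1 0 (by simpa using card_charged_le_of_mem_extremePoints h)
  interval_cases m
  · simp at hα1
  · simp only [Fin.sum_univ_one] at hα1 hq
    refine ⟨d 0, fun x u => ?_⟩
    rw [hρ x u, hq, hα1, one_mul]

/-- The frequencies of the deterministic policies. -/
def deterministicFrequencies (M : MOMDP X U K) : Set (X → U → ℝ) :=
  {φ | φ ∈ M.Φ ∧ ∃ d : X → U, Disintegrates φ (StationaryPolicy.deterministic d)}

theorem Unichain.finite_deterministicFrequencies {M : MOMDP X U K} (hM : M.Unichain) :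
    M.deterministicFrequencies.Finite := by
  classical
  choose F hF hF' using fun d : X → U => M.exists_disintegrates (StationaryPolicy.deterministic d)
  refine (Set.finite_range F).subset ?_
  rintro φ ⟨hφ, d, hd⟩
  exact ⟨d, hM.disintegrates_unique (hF d) hφ (hF' d) hd⟩

theorem Unichain.Φ_eq_convexHull {M : MOMDP X U K} (hM : M.Unichain) :
    M.Φ = convexHull ℝ M.deterministicFrequencies := by
  refine Set.Subset.antisymm ?_ (convexHull_min (fun φ h => h.1) M.convex_Φ)
  rw [← closure_convexHull_extremePoints M.isCompact_Φ M.convex_Φ]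
  refine closure_minimal (convexHull_mono fun φ h =>
    ⟨h.1, exists_deterministic_of_mem_extremePoints h⟩) ?_
  exact hM.finite_deterministicFrequencies.isClosed_convexHull ℝ

theorem ParetoOptimal.objectiveCombination {M : MOMDP X U K} {π : Policy X U}
    (h : M.ParetoOptimal π) (hK : 0 < K) (hM : M.Unichain) : M.ObjectiveCombination π := by
  classical
  have hund := h.undominated hM
  obtain ⟨φ₀, hφ₀, hc⟩ := h.exists_costMap_eq hM
  have hmem : M.J π ∈ convexHull ℝ (M.costMap '' M.deterministicFrequencies) := by
    rw [← LinearMap.image_convexHull M.costMap, ← Unichain.Φ_eq_convexHull hM]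
    exact ⟨φ₀, hφ₀, hc⟩
  obtain ⟨ι, _, z, w, hz, hind, hw, hw1, hsum⟩ := eq_pos_convex_span_of_mem_convexHull hmem
  choose ψ hψ hψz using fun i => hz (Set.mem_range_self i)
  choose hψΦ d hd using hψ
  -- As all weights are positive, every `ψ i` is supported in the support of this `φ`.
  set φ := ∑ i, w i • ψ i with hφdef
  have hφ : φ ∈ M.Φ := M.convex_Φ.sum_mem (fun i _ => (hw i).le) hw1 fun i _ => hψΦ i
  have hφc : M.costMap φ = M.J π := by simp [hφdef, hψz, hsum]
  have hsupp : ∀ i x u, φ x u = 0 → ψ i x u = 0 := fun i x u h0 => by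
    simp only [hφdef, Finset.sum_apply, Pi.smul_apply, smul_eq_mul] at h0
    have := (Finset.sum_eq_zero_iff_of_nonneg fun i _ =>
      mul_nonneg (hw i).le ((hψΦ i).2.2 x u)).1 h0 i (Finset.mem_univ i)
    exact (mul_eq_zero.1 this).resolve_left (hw i).ne'
  rw [← hφc] at hund
  have hcard : Fintype.card ι ≤ K := by
    set T : (ι → ℝ) →ₗ[ℝ] (Fin K → ℝ) × ℝ :=
      (Fintype.linearCombination ℝ z).prod (Fintype.linearCombination ℝ fun _ => 1) with hT
    have hTapply : ∀ a, T a = (∑ i, a i • z i, ∑ i, a i) := fun a => by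
      simp [hT, Fintype.linearCombination_apply]
    have hinj : Function.Injective T := by
      rw [injective_iff_map_eq_zero]
      intro a ha
      rw [hTapply] at ha
      obtain ⟨h1, h2⟩ := Prod.mk.inj ha
      exact funext fun i => (affineIndependent_iff.1 hind) Finset.univ a h2 h1 i
        (Finset.mem_univ i)
    by_contra! hlt
    -- More than `K` affinely independent points would make `T` onto, giving weights of sum zero
    -- that lower every cost by one.
    obtain ⟨a, ha⟩ := T.surjective_of_injective_of_finrank_le hinj
      (by simpa using hlt) (fun _ => -1, 0)
    rw [hTapply] at ha
    obtain ⟨h1, h2⟩ := Prod.mk.inj ha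
    have hψ' := fun i => (M.mem_Φ_iff (ψ i)).1 (hψΦ i)
    refine hund.not_costMap_eq_neg_one hK hφ (v := ∑ i, a i • ψ i) (fun x u h0 => ?_) ?_ ?_ ?_
    · simp [Finset.sum_apply, hsupp _ x u h0]
    · simp [(hψ' _).1]
    · simp [(hψ' _).2.1, h2]
    · simp [hψz, h1]
  set e := Fintype.equivFin ι
  refine ⟨Fintype.card ι, hcard, w ∘ e.symm, d ∘ e.symm, fun i => (hw _).le, ?_, fun i => ?_, ?_⟩
  · rw [← hw1]; exact e.symm.sum_comp w
  · refine Undominated.paretoOptimal ?_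
    rw [Function.comp_apply, hM.J_eq_costMap (hψΦ _) (hd _)]
    exact hund.of_support hφ (hψΦ _) (hsupp _)
  · rw [← hsum, ← e.symm.sum_comp]
    refine Finset.sum_congr rfl fun i _ => ?_
    rw [Function.comp_apply, Function.comp_apply, hM.J_eq_costMap (hψΦ _) (hd _), hψz]

end Combination

/-! ### Scalarized minimizers are Pareto optimal. -/

theorem ScalarizedOptimal.paretoOptimal {M : MOMDP X U K} {f : (Fin K → ℝ) → ℝ}
    (hf : StrictMonoOn f (M.achievable Set.univ)) {π : Policy X U}
    (h : M.ScalarizedOptimal f Set.univ π) : M.ParetoOptimal π := by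
  rintro ⟨σ, hσ, i, hi⟩
  have hlt : M.J σ < M.J π := Pi.lt_def.2 ⟨hσ, i, hi⟩
  exact (h.2 σ trivial).not_gt (hf ⟨σ, trivial, rfl⟩ ⟨π, trivial, rfl⟩ hlt)

/-- Comparison with stationary policies suffices, as they realize all of `Φ` and undominatedness
there implies Pareto optimality among all policies. -/
theorem ScalarizedOptimal.paretoOptimal_of_stationary {M : MOMDP X U K} (hM : M.Unichain)
    {f : (Fin K → ℝ) → ℝ} (hf : StrictMonoOn f M.JΦ) {π : Policy X U}
    (h : M.ScalarizedOptimal f (stationaryPolicies X U) π) : M.ParetoOptimal π := by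
  refine Undominated.paretoOptimal fun ψ hψ hle => ?_
  obtain ⟨π₀, rfl⟩ := h.1
  obtain ⟨σ, hσ⟩ := hM.exists_stationary_J_eq hψ
  by_contra hne
  refine (h.2 σ.toPolicy ⟨σ, rfl⟩).not_gt (hf (hM.J_stationary_mem σ) (hM.J_stationary_mem π₀) ?_)
  rw [hσ]
  exact hle.lt_of_ne hne

end MOMDP

theorem theorem3 {X U : Type*} [Fintype X] [Fintype U] {K : ℕ} (hK : 0 < K)
    (M : MOMDP X U K) (hM : M.Unichain) (f : (Fin K → ℝ) → ℝ) :
    (StrictMonoOn f (M.achievable Set.univ) →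
      ∀ π : Policy X U, M.ScalarizedOptimal f Set.univ π →
        M.ParetoOptimal π ∧ M.ObjectiveCombination π ∧ M.PolicyCombination π) ∧
    (StrictMonoOn f M.JΦ →
      ∀ π : Policy X U, M.ScalarizedOptimal f (stationaryPolicies X U) π →
        M.ParetoOptimal π ∧ M.ObjectiveCombination π ∧ M.PolicyCombination π) := by
  refine ⟨fun hf π h => ?_, fun hf π h => ?_⟩
  · have hP := h.paretoOptimal hf
    exact ⟨hP, hP.objectiveCombination hK hM, hP.policyCombination hK hM⟩
  · have hP := h.paretoOptimal_of_stationary hM hf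
    exact ⟨hP, hP.objectiveCombination hK hM, hP.policyCombination hK hM⟩
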